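/- Let $\Phi_0,\Phi_1,\dots$ be an effective (acceptable) enumeration of all partial computable functionals on Baire space $\mathbb{N}^{\mathbb{N}}$; functionals of two arguments $p,q$ are applied to the join of $p$ and $q$. A problem is a partial multi-valued function $f$ on $\mathbb{N}^{\mathbb{N}}$, with domain $\operatorname{dom}(f)=\{p : f(p)\neq\emptyset\}$. Write $f\le_{\mathrm W} g$ ($f$ is Weihrauch reducible to $g$) if there are partial computable functionals $\Phi,\Psi$ such that for every $p\in\operatorname{dom}(f)$, $\Phi(p)$ is defined and in $\operatorname{dom}(g)$, and for every $q\in g(\Phi(p))$, $\Psi(p,q)$ is defined and in $f(p)$. Write $f\equiv_{\mathrm W} g$ if $f\le_{\mathrm W} g$ and $g\le_{\mathrm W} f$, and $f<_{\mathrm W} g$ if $f\le_{\mathrm W} g$ and $g\not\le_{\mathrm W} f$. The totalizing jump of a problem $f$ is the total problem $\mathsf{tJ}(f)$ with instances $(e,i,p)\in\mathbb{N}\times\mathbb{N}\times\mathbb{N}^{\mathbb{N}}$ (coded as the sequence $e,i,p(0),p(1),\dots$) given by $$\mathsf{tJ}(f)(e,i,p)=\begin{cases}\{\Phi_i(p,q)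 : q\in f(\Phi_e(p))\} & \text{if } \Phi_e(p)\text{ is defined and in }\operatorname{dom}(f)\text{ and } \Phi_i(p,q)\text{ is defined for all } q\in f(\Phi_e(p)),\\ \mathbb{N}^{\mathbb{N}} & \text{otherwise.}\end{cases}$$ The parallelization $\widehat{f}$ of $f$ maps a (coded) sequence $\langle x_0,x_1,\dots\rangle$ of elements of $\operatorname{dom}(f)$ to the set of all (coded) sequences $\langle y_0,y_1,\dots\rangle$ with $y_j\in f(x_j)$ for every $j$. Let $\mathrm{id}$ be the identity on $\mathbb{N}^{\mathbb{N}}$; let $\mathsf{LPO}:\mathbb{N}^{\mathbb{N}}\to\{0,1\}$ be given by $\mathsf{LPO}(p)=1$ if and only if $p(n)\neq0$ for some $n$, where a number $k$ is represented by any $q\in\mathbb{N}^{\mathbb{N}}$ with $q(0)=k$; and let $\mathsf{lim}$ map a convergent (coded) sequence of elements of $\mathbb{N}^{\mathbb{N}}$ to its limit. Then $$\mathsf{LPO}<_{\mathrm W}\mathsf{tJ}(\mathrm{id})<_{\mathrm W}\widehat{\mathsf{tJ}(\mathrm{id})}\equiv_{\mathrm W}\mathsf{lim}.$$ -/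

import Mathlib

namespace Weihrauch

/-- Baire space. -/
abbrev Baire : Type := ℕ → ℕ

/-- The finite prefix `p(0), …, p(k-1)` of `p`. -/
def initSeg (p : Baire) (k : ℕ) : List ℕ := (List.range k).map p

/-- The `e`-th partial recursive function `φ_e`, applied to the pair consisting of the prefix
of length `k` of `p` and the number `n`. -/
def query (e : ℕ) (p : Baire) (n k : ℕ) : Part ℕ :=
  (Denumerable.ofNat Nat.Partrec.Code e).eval (Encodable.encode (initSeg p k, n))

/-- The `n`-th digit of `Φ_e(p)`. The algorithm with oracle `p` evaluates `φ_e(p[k], n)` for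
`k = 0, 1, 2, …`. The value `0` means that a longer prefix of the oracle is wanted, a value
`m + 1` means that the output is `m`; the digit is undefined if some evaluation that is reached
diverges, or if every value is `0`. Every oracle machine has this form: let `φ_e(σ, n)` run it
for `|σ|` steps, with oracle queries answered from `σ`, and return `m + 1` if it has
halted with output `m` and `0` otherwise (also if a query reaches beyond `σ`). -/
def phiDigit (e : ℕ) (p : Baire) (n : ℕ) : Part ℕ :=
  (Nat.rfind fun k => (query e p n k).map fun v => decide (v ≠ 0)).bind fun k =>
    (query e p n k).map Nat.pred

/-- The effective enumeration `Φ_0, Φ_1, …` of all partial computable functionals on Baire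
space. `Φ_e(p)` is defined exactly if all its digits are. -/
def Phi (e : ℕ) : Baire → Part Baire := fun p =>
  ⟨∀ n, (phiDigit e p n).Dom, fun h n => (phiDigit e p n).get (h n)⟩

/-- Partial computable functionals on Baire space. -/
def ComputableFunctional (F : Baire → Part Baire) : Prop := ∃ e, F = Phi e

/-- The join of `p` and `q`; a functional of two arguments is a functional of their join. -/
def join (p q : Baire) : Baire := fun n => if n % 2 = 0 then p (n / 2) else q (n / 2)

/-- A partial multi-valued function on Baire space. -/
abbrev Problem : Type := Baire → Set Baire

/-- The domain of a partial multi-valued function. -/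
def Problem.dom (f : Problem) : Set Baire := {p | (f p).Nonempty}

/-- Weihrauch reducibility `f ≤_W g`. -/
def Reducible (f g : Problem) : Prop :=
  ∃ F G : Baire → Part Baire, ComputableFunctional F ∧ ComputableFunctional G ∧
    ∀ p ∈ f.dom, ∃ x ∈ F p, x ∈ g.dom ∧ ∀ q ∈ g x, ∃ y ∈ G (join p q), y ∈ f p

/-- Strict Weihrauch reducibility `f <_W g`. -/
def StrictlyReducible (f g : Problem) : Prop := Reducible f g ∧ ¬ Reducible g f

/-- Weihrauch equivalence `f ≡_W g`. -/
def Equivalent (f g : Problem) : Prop := Reducible f g ∧ Reducible g f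

/-- The identity problem on Baire space. -/
def idProblem : Problem := fun p => {p}

/-- `LPO(p) = 1` if `p` has a nonzero entry and `LPO(p) = 0` otherwise; a number `n` is
represented by any `q` with `q(0) = n`. -/
def LPO : Problem := fun p =>
  {q | (q 0 = 1 ∧ ∃ n, p n ≠ 0) ∨ (q 0 = 0 ∧ ∀ n, p n = 0)}

/-- The `i`-th component `x_i` of `x = ⟨x_0, x_1, …⟩`, where `x(⟨i,j⟩) = x_i(j)`. -/
def component (x : Baire) (i : ℕ) : Baire := fun j => x (Nat.pair i j)

/-- The limit problem: the instances are the (coded) sequences of elements of Baire space which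
converge, and the only solution is the limit. -/
def limProblem : Problem := fun x =>
  {y | Filter.Tendsto (component x) Filter.atTop (nhds y)}

/-- The parallelization of `f`. The instances are the sequences of instances of `f`. -/
def parallelization (f : Problem) : Problem := fun x =>
  {y | ∀ i, component y i ∈ f (component x i)}

open Classical in
/-- The totalizing jump `tJ(f)`; the instance `(e, i, p)` is coded as the sequence
`e, i, p(0), p(1), …`. -/
noncomputable def totJump (f : Problem) : Problem := fun x =>
  let e := x 0
  let i := x 1
  let p : Baire := fun n => x (n + 2)
  if ∃ z ∈ Phi e p, z ∈ f.dom ∧ ∀ q ∈ f z, (Phi i (join p q)).Dom then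
    {y | ∃ z ∈ Phi e p, ∃ q ∈ f z, y ∈ Phi i (join p q)}
  else Set.univ

end Weihrauch

namespace Weihrauch

open Nat.Partrec (Code)

/-! ### The enumeration of the partial computable functionals -/

/-! An instance `(e, i, p)` of `tJ(id)` is a computation of `Φ_i(p, Φ_e(p))` that may fail: if it
succeeds, its output is the only solution, otherwise everything is a solution (`mem_totJump_id`).
Searching `p` for a nonzero entry is such a computation, and a claimed witness can be checked
against `p`. So an arbitrary answer to a failed search does no harm, and `LPO` reduces to `tJ(id)`.

Both strictness results rest on continuity. Near a suitable instance one fixed answer of `LPO` is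
correct, so a reduction of `tJ(id)` to `LPO` would solve `tJ(id)` there by a continuous function,
which diagonalization excludes. A reduction to `tJ(id)` leaves two continuous strategies, one using
the prescribed output and one using the zero sequence when nothing is prescribed
(`exists_relContinuous_of_reducible`). Two searches in parallel already require three strategies: no
witness, then a late witness in the first search, then a still later one in the second.

For `lim`, parallel searches ask for each digit `n` and stage `N` whether the digit changes after
`N`; an `N` without change reveals the limit. Conversely, the stage-`s` approximations to a digit of
`Φ_i(p, Φ_e(p))` change at most once, from "unknown" to the value. They therefore converge even if
the computation fails, and one use of `lim` yields all digits of all instances. -/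

theorem mem_phiDigit {e : ℕ} {p : Baire} {n v : ℕ} :
    v ∈ phiDigit e p n ↔
      ∃ k, v + 1 ∈ query e p n k ∧ ∀ k' < k, 0 ∈ query e p n k' := by
  unfold phiDigit
  simp only [Part.mem_bind_iff, Part.mem_map_iff]
  constructor
  · rintro ⟨k, hr, b, hb, rfl⟩
    obtain ⟨hk, hlt⟩ := Nat.mem_rfind.1 hr
    obtain ⟨a, ha, ha0⟩ := (Part.mem_map_iff _).1 hk
    obtain rfl := Part.mem_unique ha hb
    refine ⟨k, ?_, fun k' hk' => ?_⟩
    · rwa [← Nat.succ_eq_add_one, Nat.succ_pred_eq_of_ne_zero (of_decide_eq_true ha0)]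
    · obtain ⟨c, hc, hc0⟩ := (Part.mem_map_iff _).1 (hlt hk')
      rwa [not_not.1 (of_decide_eq_false hc0)] at hc
  · rintro ⟨k, hv, hk⟩
    refine ⟨k, Nat.mem_rfind.2 ⟨(Part.mem_map_iff _).2 ⟨_, hv, by simp⟩, fun hm => ?_⟩, _, hv, rfl⟩
    exact (Part.mem_map_iff _).2 ⟨0, hk _ hm, by simp⟩

theorem mem_Phi {e : ℕ} {p y : Baire} : y ∈ Phi e p ↔ ∀ n, y n ∈ phiDigit e p n := by
  constructor
  · rintro ⟨h, rfl⟩ n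
    exact Part.get_mem (h n)
  · intro h
    exact ⟨fun n => (h n).1, funext fun n => Part.get_eq_of_mem (h n) (h n).1⟩

theorem initSeg_length (p : Baire) (k : ℕ) : (initSeg p k).length = k := by simp [initSeg]

theorem initSeg_getD (p : Baire) {i k : ℕ} (h : i < k) : (initSeg p k).getD i 0 = p i := by
  simp [initSeg, List.getD, h]

theorem initSeg_congr {p p' : Baire} {k : ℕ} (h : ∀ j < k, p' j = p j) :
    initSeg p' k = initSeg p k :=
  List.map_congr_left fun j hj => h j (List.mem_range.1 hj)

theorem take_initSeg (p : Baire) {j k : ℕ} (h : j ≤ k) : (initSeg p k).take j = initSeg p j := by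
  simp [initSeg, ← List.map_take, List.take_range, h]

theorem initSeg_prefix (p : Baire) {j k : ℕ} (h : j ≤ k) : initSeg p j <+: initSeg p k := by
  rw [← take_initSeg p h]
  exact List.take_prefix _ _

/-- Every digit of the output depends on a finite prefix of the oracle only. -/
theorem phiDigit_continuous {e : ℕ} {p : Baire} {n v : ℕ} (h : v ∈ phiDigit e p n) :
    ∃ K, ∀ p' : Baire, (∀ j < K, p' j = p j) → v ∈ phiDigit e p' n := by
  obtain ⟨k, hv, hk⟩ := mem_phiDigit.1 h
  refine ⟨k, fun p' hp' => mem_phiDigit.2 ⟨k, ?_, fun k' hk' => ?_⟩⟩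
  · rwa [query, initSeg_congr hp']
  · rw [query, initSeg_congr fun j hj => hp' j (hj.trans hk')]
    exact hk k' hk'

theorem exists_query {h : List ℕ → ℕ → ℕ} (hh : Primrec₂ h) :
    ∃ e, ∀ p n k, query e p n k = Part.some (h (initSeg p k) n) := by
  -- The default `0` is never met in `query`, whose arguments are always codes of pairs.
  have hP : Nat.Partrec fun m =>
      Part.some (((Encodable.decode (α := List ℕ × ℕ) m).map fun a => h a.1 a.2).getD 0) := by
    refine Nat.Partrec.of_primrec (Primrec.nat_iff.1 ?_)
    refine Primrec.option_getD.comp ?_ (Primrec.const 0)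
    exact Primrec.option_map Primrec.decode (hh.comp (Primrec.fst.comp Primrec.snd)
      (Primrec.snd.comp Primrec.snd)).to₂
  obtain ⟨c, hc⟩ := Code.exists_code.1 hP
  refine ⟨Encodable.encode c, fun p n k => ?_⟩
  simp [query, hc]

/-- A functional given by a primitive recursive function on prefixes, where the value `0` means
that a longer prefix is wanted. -/
theorem exists_Phi_of_prefix {h : List ℕ → ℕ → ℕ} (hh : Primrec₂ h) :
    ∃ e, ∀ p y : Baire,
      (∀ n k, h (initSeg p k) n = 0 ∨ h (initSeg p k) n = y n + 1) →
      (∀ n, ∃ k, h (initSeg p k) n ≠ 0) → y ∈ Phi e p := by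
  obtain ⟨e, he⟩ := exists_query hh
  refine ⟨e, fun p y h1 h2 => mem_Phi.2 fun n => mem_phiDigit.2 ?_⟩
  refine ⟨Nat.find (h2 n), ?_, fun k' hk' => ?_⟩
  · rw [he, Part.mem_some_iff]
    exact ((h1 n _).resolve_left (Nat.find_spec (h2 n))).symm
  · rw [he, Part.mem_some_iff]
    exact (not_not.1 (Nat.find_min (h2 n) hk')).symm

/-- A total functional that reads a prefix of known length. -/
theorem exists_Phi_of_bound {b : ℕ → ℕ} (hb : Primrec b) {g : List ℕ → ℕ → ℕ} (hg : Primrec₂ g) :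
    ∃ e, ∀ p : Baire, (fun n => g (initSeg p (b n)) n) ∈ Phi e p := by
  have hh : Primrec₂ fun (σ : List ℕ) n =>
      if b n ≤ σ.length then g (σ.take (b n)) n + 1 else 0 := by
    refine Primrec.ite (Primrec.nat_le.comp (hb.comp .snd) (Primrec.list_length.comp .fst)) ?_
      (Primrec.const 0)
    exact Primrec.succ.comp (hg.comp (Primrec.list_take.comp (hb.comp .snd) .fst) .snd)
  obtain ⟨e, he⟩ := exists_Phi_of_prefix hh
  refine ⟨e, fun p => he p _ (fun n k => ?_) fun n => ⟨b n, ?_⟩⟩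
  · rw [initSeg_length]
    split_ifs with h
    · right; rw [take_initSeg p h]
    · left; rfl
  · simp [initSeg_length]

theorem exists_identity : ∃ e, ∀ p : Baire, Phi e p = Part.some p := by
  obtain ⟨e, he⟩ := exists_Phi_of_bound (b := fun n => n + 1) (g := fun σ n => σ.getD n 0)
    Primrec.succ (Primrec.list_getD 0)
  refine ⟨e, fun p => Part.eq_some_iff.2 ?_⟩
  convert he p using 1
  funext n
  exact (initSeg_getD p (Nat.lt_succ_self n)).symm

theorem join_even (p q : Baire) (n : ℕ) : join p q (2 * n) = p n := by simp [join]

theorem join_odd (p q : Baire) (n : ℕ) : join p q (2 * n + 1) = q n := by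
  have h : (2 * n + 1) / 2 = n := by omega
  simp [join, h]

/-- A functional that searches its first argument. -/
theorem exists_search {t : ℕ → ℕ × ℕ → ℕ} (ht : Primrec₂ t) :
    ∃ i, ∀ (p z : Baire) (n v : ℕ), v ∈ phiDigit i (join p z) n ↔
      ∃ m, t n (m, p m) = v + 1 ∧ ∀ m' < m, t n (m', p m') = 0 := by
  -- The last entry of a prefix of length `2 * m + 1` of the join is `p m`. Thus each entry of `p`
  -- is tested once, in order, and even lengths are skipped.
  have hh : Primrec₂ fun (σ : List ℕ) n =>
      if σ.length % 2 = 1 then t n (σ.length / 2, σ.getD (σ.length - 1) 0) else 0 := by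
    have hl : Primrec fun a : List ℕ × ℕ => a.1.length := Primrec.list_length.comp .fst
    refine Primrec.ite (Primrec.eq.comp (Primrec.nat_mod.comp hl (.const 2)) (.const 1)) ?_
      (Primrec.const 0)
    exact ht.comp .snd ((Primrec.nat_div.comp hl (.const 2)).pair
      ((Primrec.list_getD 0).comp .fst (Primrec.nat_sub.comp hl (.const 1))))
  obtain ⟨i, hi⟩ := exists_query hh
  refine ⟨i, fun p z n v => ?_⟩
  have hq : ∀ m, query i (join p z) n (2 * m + 1) = Part.some (t n (m, p m)) := by
    intro m
    have h1 : (2 * m + 1) % 2 = 1 := by omega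
    have h2 : (2 * m + 1) / 2 = m := by omega
    rw [hi, initSeg_length, if_pos h1, h2, Nat.add_sub_cancel, initSeg_getD _ (by omega),
      join_even]
  have hq0 : ∀ m, query i (join p z) n (2 * m) = Part.some 0 := by
    intro m
    rw [hi, initSeg_length, if_neg (by omega)]
  rw [mem_phiDigit]
  constructor
  · rintro ⟨k, hv, hk⟩
    obtain ⟨m, rfl | rfl⟩ := Nat.even_or_odd' k
    · rw [hq0, Part.mem_some_iff] at hv
      omega
    · refine ⟨m, ?_, fun m' hm' => ?_⟩
      · rw [hq, Part.mem_some_iff] at hv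
        exact hv.symm
      · have := hk (2 * m' + 1) (by omega)
        rw [hq, Part.mem_some_iff] at this
        exact this.symm
  · rintro ⟨m, hv, hm⟩
    refine ⟨2 * m + 1, ?_, fun k' hk' => ?_⟩
    · rw [hq, hv]; exact Part.mem_some _
    · obtain ⟨m', rfl | rfl⟩ := Nat.even_or_odd' k'
      · rw [hq0]; exact Part.mem_some _
      · rw [hq, hm m' (by omega)]; exact Part.mem_some _

/-! ### The totalizing jump of the identity -/

/-- Functionals are single-valued, so both cases of the jump merge: if no output is prescribed the
condition is vacuous. -/
theorem mem_totJump_id {x y : Baire} :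
    y ∈ totJump idProblem x ↔ ∀ z w, z ∈ Phi (x 0) (fun n => x (n + 2)) →
      w ∈ Phi (x 1) (join (fun n => x (n + 2)) z) → y = w := by
  unfold totJump
  by_cases h : ∃ z ∈ Phi (x 0) (fun n => x (n + 2)), z ∈ idProblem.dom ∧
      ∀ q ∈ idProblem z, (Phi (x 1) (join (fun n => x (n + 2)) q)).Dom
  · rw [if_pos h]
    obtain ⟨z, hz, -, hd⟩ := h
    have hd := hd z rfl
    constructor
    · rintro ⟨z', hz', q, rfl, hy⟩ z'' w hz'' hw
      obtain rfl := Part.mem_unique hz' hz''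
      exact Part.mem_unique hy hw
    · intro h
      exact ⟨z, hz, z, rfl, h z _ hz (Part.get_mem hd) ▸ Part.get_mem hd⟩
  · rw [if_neg h]
    refine ⟨fun _ z w hz hw => absurd ⟨z, hz, ⟨z, rfl⟩, fun q hq => ?_⟩ h, fun _ => trivial⟩
    obtain rfl : q = z := hq
    exact hw.1

theorem totJump_id_nonempty (x : Baire) : (totJump idProblem x).Nonempty := by
  by_cases h : ∃ z w, z ∈ Phi (x 0) (fun n => x (n + 2)) ∧
      w ∈ Phi (x 1) (join (fun n => x (n + 2)) z)
  · obtain ⟨z, w, hz, hw⟩ := h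
    refine ⟨w, mem_totJump_id.2 fun z' w' hz' hw' => ?_⟩
    obtain rfl := Part.mem_unique hz hz'
    exact Part.mem_unique hw hw'
  · exact ⟨fun _ => 0, mem_totJump_id.2 fun z w hz hw => absurd ⟨z, w, hz, hw⟩ h⟩

theorem parallelization_totJump_id_nonempty (x : Baire) :
    (parallelization (totJump idProblem) x).Nonempty := by
  choose y hy using fun j => totJump_id_nonempty (component x j)
  refine ⟨fun m => y m.unpair.1 m.unpair.2, fun j => ?_⟩
  convert hy j using 1
  funext n
  simp [component]

/-- The code of the instance `(e, i, p)` of the totalizing jump. -/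
def jumpInstance (e i : ℕ) (p : Baire) : Baire := fun n =>
  if n = 0 then e else if n = 1 then i else p (n - 2)

theorem mem_totJump_id_jumpInstance {e i : ℕ} {p y : Baire} :
    y ∈ totJump idProblem (jumpInstance e i p) ↔
      ∀ z w, z ∈ Phi e p → w ∈ Phi i (join p z) → y = w := by
  rw [mem_totJump_id]
  rfl

theorem jumpInstance_congr (e i : ℕ) {p p' : Baire} {K : ℕ} (h : ∀ j < K, p' j = p j) :
    ∀ j < K, jumpInstance e i p' j = jumpInstance e i p j := by
  intro j hj
  unfold jumpInstance
  split_ifs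
  · rfl
  · rfl
  · exact h _ (by omega)

/-- Instances of `tJ(id)` which decide whether a sequence has a nonzero entry. -/
theorem exists_jumpInstance_LPO : ∃ e i, ∀ p y : Baire,
    y ∈ totJump idProblem (jumpInstance e i p) → (∃ n, p n ≠ 0) →
      y 0 ≠ 0 ∧ p (y 0 - 1) ≠ 0 := by
  obtain ⟨e, he⟩ := exists_identity
  -- A nonzero entry at `m` ends the search with the value `m + 2`, that is, with output `m + 1`;
  -- the digit `0` is then never the answer of a successful search.
  have ht : Primrec₂ fun (_ : ℕ) (a : ℕ × ℕ) => if a.2 = 0 then 0 else a.1 + 2 := by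
    refine Primrec.ite (Primrec.eq.comp (Primrec.snd.comp .snd) (.const 0)) (.const 0) ?_
    exact Primrec.nat_add.comp (Primrec.fst.comp .snd) (.const 2)
  obtain ⟨i, hi⟩ := exists_search ht
  refine ⟨e, i, fun p y hy hp => ?_⟩
  have hw : (fun _ => Nat.find hp + 1) ∈ Phi i (join p p) := by
    refine mem_Phi.2 fun n => (hi p p n _).2 ⟨Nat.find hp, ?_, fun m' hm' => ?_⟩
    · rw [if_neg (Nat.find_spec hp)]
    · rw [if_pos (not_not.1 (Nat.find_min hp hm'))]
  rw [mem_totJump_id_jumpInstance.1 hy p _ (by rw [he]; exact Part.mem_some p) hw]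
  exact ⟨Nat.succ_ne_zero _, Nat.find_spec hp⟩

/-- Instances of `tJ(id)` which output, at each position `n`, the first nonzero entry from `n`
on. -/
theorem exists_jumpInstance_nextNonzero : ∃ e i, ∀ p y : Baire,
    y ∈ totJump idProblem (jumpInstance e i p) → (∀ n, ∃ m, n ≤ m ∧ p m ≠ 0) →
      ∀ n, ∃ m, n ≤ m ∧ p m ≠ 0 ∧ y n = p m := by
  obtain ⟨e, he⟩ := exists_identity
  have ht : Primrec₂ fun (n : ℕ) (a : ℕ × ℕ) =>
      if a.2 = 0 then 0 else if n ≤ a.1 then a.2 + 1 else 0 := by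
    refine Primrec.ite (Primrec.eq.comp (Primrec.snd.comp .snd) (.const 0)) (.const 0) ?_
    exact Primrec.ite (Primrec.nat_le.comp .fst (Primrec.fst.comp .snd))
      (Primrec.succ.comp (Primrec.snd.comp .snd)) (.const 0)
  obtain ⟨i, hi⟩ := exists_search ht
  refine ⟨e, i, fun p y hy hp => ?_⟩
  have hw : (fun n => p (Nat.find (hp n))) ∈ Phi i (join p p) := by
    refine mem_Phi.2 fun n => (hi p p n _).2 ⟨Nat.find (hp n), ?_, fun m' hm' => ?_⟩
    · rw [if_neg (Nat.find_spec (hp n)).2, if_pos (Nat.find_spec (hp n)).1]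
    · have := Nat.find_min (hp n) hm'
      split_ifs with h1 h2
      · rfl
      · exact absurd ⟨h2, h1⟩ this
      · rfl
  intro n
  rw [mem_totJump_id_jumpInstance.1 hy p _ (by rw [he]; exact Part.mem_some p) hw]
  exact ⟨Nat.find (hp n), (Nat.find_spec (hp n)).1, (Nat.find_spec (hp n)).2, rfl⟩

/-- Passing from `p` to the instance `(e, i, p)` is computable. -/
theorem exists_Phi_jumpInstance (e i : ℕ) : ∃ a, ∀ p, jumpInstance e i p ∈ Phi a p := by
  have hg : Primrec₂ fun (σ : List ℕ) (n : ℕ) =>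
      if n = 0 then e else if n = 1 then i else σ.getD (n - 2) 0 := by
    refine Primrec.ite (Primrec.eq.comp .snd (.const 0)) (.const e) ?_
    refine Primrec.ite (Primrec.eq.comp .snd (.const 1)) (.const i) ?_
    exact (Primrec.list_getD 0).comp .fst (Primrec.nat_sub.comp .snd (.const 2))
  obtain ⟨a, ha⟩ := exists_Phi_of_bound (b := fun n => n + 1) Primrec.succ hg
  refine ⟨a, fun p => ?_⟩
  convert ha p using 1
  funext n
  rw [initSeg_getD p (by omega : n - 2 < n + 1)]
  rfl

/-! ### `LPO` is strictly below `tJ(id)` -/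

/-- The answer `v` of the search claims the witness `v - 1`. Testing `p (v - 1)` decides `LPO`,
since a true witness is always delivered if there is one. -/
theorem LPO_reducible_totJump_id : Reducible LPO (totJump idProblem) := by
  obtain ⟨e, i, hei⟩ := exists_jumpInstance_LPO
  obtain ⟨a, ha⟩ := exists_Phi_jumpInstance e i
  have hh : Primrec₂ fun (σ : List ℕ) (_ : ℕ) =>
      if σ.length ≤ 1 then 0 else if σ.getD 1 0 = 0 then 1
      else if σ.length ≤ 2 * (σ.getD 1 0 - 1) then 0
      else if σ.getD (2 * (σ.getD 1 0 - 1)) 0 = 0 then 1 else 2 := by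
    have hl : Primrec fun a : List ℕ × ℕ => a.1.length := Primrec.list_length.comp .fst
    have hv : Primrec fun a : List ℕ × ℕ => a.1.getD 1 0 :=
      (Primrec.list_getD 0).comp .fst (.const 1)
    have hw : Primrec fun a : List ℕ × ℕ => 2 * (a.1.getD 1 0 - 1) :=
      Primrec.nat_double.comp (Primrec.nat_sub.comp hv (.const 1))
    refine Primrec.ite (Primrec.nat_le.comp hl (.const 1)) (.const 0) ?_
    refine Primrec.ite (Primrec.eq.comp hv (.const 0)) (.const 1) ?_
    refine Primrec.ite (Primrec.nat_le.comp hl hw) (.const 0) ?_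
    exact Primrec.ite (Primrec.eq.comp ((Primrec.list_getD 0).comp .fst hw) (.const 0))
      (.const 1) (.const 2)
  obtain ⟨b, hb⟩ := exists_Phi_of_prefix hh
  refine ⟨Phi a, Phi b, ⟨a, rfl⟩, ⟨b, rfl⟩, fun p _ => ⟨_, ha p, totJump_id_nonempty _, ?_⟩⟩
  intro q hq
  have key := hei p q hq
  refine ⟨fun _ => if q 0 = 0 then 0 else if p (q 0 - 1) = 0 then 0 else 1, ?_, ?_⟩
  · refine hb _ _ (fun n k => ?_) fun n => ⟨2 * (q 0 - 1) + 2, ?_⟩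
    · rw [initSeg_length]
      by_cases h1 : k ≤ 1
      · left; rw [if_pos h1]
      rw [if_neg h1, initSeg_getD _ (by omega : 1 < k), show join p q 1 = q 0 from join_odd p q 0]
      by_cases h2 : q 0 = 0
      · right; simp [h2]
      by_cases h3 : k ≤ 2 * (q 0 - 1)
      · left; rw [if_neg h2, if_pos h3]
      rw [if_neg h2, if_neg h3, if_neg h2, initSeg_getD _ (by omega), join_even]
      right
      split_ifs <;> rfl
    · rw [initSeg_length, initSeg_getD _ (by omega : 1 < _),
        show join p q 1 = q 0 from join_odd p q 0, if_neg (by omega)]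
      by_cases h2 : q 0 = 0
      · simp [h2]
      rw [if_neg h2, if_neg (by omega)]
      split_ifs <;> simp
  · by_cases hp : ∃ n, p n ≠ 0
    · obtain ⟨h1, h2⟩ := key hp
      left
      exact ⟨by simp [h1, h2], hp⟩
    · right
      push Not at hp
      exact ⟨by simp [hp], hp⟩

/-- If some `LPO` instance that is produced has a nonzero entry, then by continuity answer 1 is
correct for all nearby `p`; otherwise answer 0 is correct for all `p`. In both cases a fixed answer
makes the backward functional solve the next-nonzero-entry problem near some `p₀`, which `key`
refutes. -/
theorem not_totJump_id_reducible_LPO : ¬ Reducible (totJump idProblem) LPO := by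
  rintro ⟨F, G, ⟨a, rfl⟩, ⟨b, rfl⟩, hred⟩
  obtain ⟨e, i, hei⟩ := exists_jumpInstance_nextNonzero
  have hred' := fun p => hred (jumpInstance e i p) (totJump_id_nonempty _)
  have key : ∀ (q p₀ : Baire) (N : ℕ), ¬ ∀ p : Baire, (∀ j < N, p j = p₀ j) →
      ∃ y ∈ Phi b (join (jumpInstance e i p) q), y ∈ totJump idProblem (jumpInstance e i p) := by
    intro q p₀ N h
    -- The extension by zeros serves only to force the backward functional to commit to an `N`-th
    -- digit.
    obtain ⟨y, hy, -⟩ := h (fun j => if j < N then p₀ j else 0) fun j hj => if_pos hj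
    obtain ⟨K, hK⟩ := phiDigit_continuous (mem_Phi.1 hy N)
    -- From position `N` on, the only nonzero entry of `p'` is `y N + 1`, so the correct `N`-th
    -- digit differs from the digit `y N` already fixed by the first `K` entries.
    set p' : Baire := fun j => if j < N then p₀ j else if j < K then 0 else y N + 1 with hp'
    obtain ⟨y', hy', hs⟩ := h p' fun j hj => if_pos hj
    have h1 : y N ∈ phiDigit b (join (jumpInstance e i p') q) N := by
      refine hK _ fun j hj => ?_
      unfold join
      split_ifs
      · refine jumpInstance_congr e i (K := K) (fun l hl => ?_) _ (by omega)
        simp [hp', hl]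
      · rfl
    have h2 : y' N = y N := Part.mem_unique (mem_Phi.1 hy' N) h1
    obtain ⟨m, hm, hm0, hym⟩ := hei p' y' hs (fun n => ⟨n + N + K, by omega, by
      simp only [hp']; rw [if_neg (by omega), if_neg (by omega)]; omega⟩) N
    simp only [hp'] at hm0 hym
    rw [if_neg (by omega)] at hm0 hym
    split_ifs at hm0 hym
    · exact hm0 rfl
    · omega
  by_cases hne : ∃ p, ∃ x ∈ Phi a (jumpInstance e i p), ∃ m, x m ≠ 0
  · obtain ⟨p₀, x, hx, m, hm⟩ := hne
    obtain ⟨K, hK⟩ := phiDigit_continuous (mem_Phi.1 hx m)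
    refine key (fun _ => 1) p₀ K fun p hp => ?_
    obtain ⟨x', hx', -, hq⟩ := hred' p
    have h1 : x' m = x m :=
      Part.mem_unique (mem_Phi.1 hx' m) (hK _ (jumpInstance_congr e i hp))
    exact hq _ (Or.inl ⟨rfl, m, h1 ▸ hm⟩)
  · push Not at hne
    refine key (fun _ => 0) (fun _ => 0) 0 fun p _ => ?_
    obtain ⟨x, hx, -, hq⟩ := hred' p
    exact hq _ (Or.inr ⟨rfl, hne p x hx⟩)

/-! ### `tJ(id)` is strictly below its parallelization -/

/-- Relabelling the positions and applying a function to the entries is computable. -/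
theorem exists_Phi_reindex {r f : ℕ → ℕ} (hr : Primrec r) (hf : Primrec f) :
    ∃ e, ∀ p : Baire, (fun n => f (p (r n))) ∈ Phi e p := by
  obtain ⟨e, he⟩ := exists_Phi_of_bound (b := fun n => r n + 1)
    (g := fun σ n => f (σ.getD (r n) 0)) (Primrec.succ.comp hr)
    (hf.comp ((Primrec.list_getD 0).comp .fst (hr.comp .snd)))
  refine ⟨e, fun p => ?_⟩
  convert he p using 1
  funext n
  rw [initSeg_getD p (Nat.lt_succ_self _)]

theorem totJump_id_reducible_parallelization :
    Reducible (totJump idProblem) (parallelization (totJump idProblem)) := by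
  obtain ⟨a, ha⟩ := exists_Phi_reindex (Primrec.snd.comp Primrec.unpair) Primrec.id
  obtain ⟨b, hb⟩ := exists_Phi_reindex (r := fun n => 2 * Nat.pair 0 n + 1)
    (Primrec.nat_double_succ.comp (Primrec₂.natPair.comp (.const 0) .id)) Primrec.id
  refine ⟨Phi a, Phi b, ⟨a, rfl⟩, ⟨b, rfl⟩, fun p _ =>
    ⟨_, ha p, parallelization_totJump_id_nonempty _, fun q hq => ⟨_, hb _, ?_⟩⟩⟩
  have h := hq 0
  have hp : component (fun n => id (p n.unpair.2)) 0 = p := by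
    funext n
    simp [component]
  rw [hp] at h
  convert h using 1
  funext n
  simp only [id, join_odd, component]

/-- A relation on Baire space is continuous if any finite part of the right-hand side is determined
by a finite part of the left-hand side. -/
def RelContinuous (R : Baire → Baire → Prop) : Prop :=
  ∀ x y, R x y → ∀ N, ∃ K, ∀ x' y', (∀ j < K, x' j = x j) → R x' y' → ∀ j < N, y' j = y j

theorem relContinuous_of_pointwise {R : Baire → Baire → Prop}
    (h : ∀ x y, R x y → ∀ n, ∃ K, ∀ x' y', (∀ j < K, x' j = x j) → R x' y' → y' n = y n) :
    RelContinuous R := by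
  intro x y hxy N
  choose K hK using h x y hxy
  refine ⟨(Finset.range N).sup K, fun x' y' hx' hR j hj => hK j x' y' (fun l hl => hx' l ?_) hR⟩
  exact hl.trans_le (Finset.le_sup (f := K) (Finset.mem_range.2 hj))

theorem relContinuous_Phi (e : ℕ) : RelContinuous fun x y => y ∈ Phi e x := by
  refine relContinuous_of_pointwise fun x y hy n => ?_
  obtain ⟨K, hK⟩ := phiDigit_continuous (mem_Phi.1 hy n)
  exact ⟨K, fun x' y' hx' hy' => Part.mem_unique (mem_Phi.1 hy' n) (hK x' hx')⟩

theorem RelContinuous.comp {R S : Baire → Baire → Prop} (hR : RelContinuous R)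
    (hS : RelContinuous S) : RelContinuous fun x z => ∃ y, R x y ∧ S y z := by
  rintro x z ⟨y, hxy, hyz⟩ N
  obtain ⟨K, hK⟩ := hS y z hyz N
  obtain ⟨L, hL⟩ := hR x y hxy K
  refine ⟨L, ?_⟩
  rintro x' z' hx' ⟨y', hxy', hyz'⟩
  exact hK y' z' (hL x' y' hx' hxy') hyz'

theorem join_congr {p p' q q' : Baire} {K : ℕ} (hp : ∀ j < K, p' j = p j)
    (hq : ∀ j < K, q' j = q j) : ∀ j < K, join p' q' j = join p q j := by
  intro j hj
  unfold join
  split_ifs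
  · exact hp _ (by omega)
  · exact hq _ (by omega)

theorem RelContinuous.join {R S : Baire → Baire → Prop} (hR : RelContinuous R)
    (hS : RelContinuous S) :
    RelContinuous fun x u => ∃ y z, R x y ∧ S x z ∧ u = Weihrauch.join y z := by
  rintro x _ ⟨y, z, hy, hz, rfl⟩ N
  obtain ⟨K, hK⟩ := hR x y hy N
  obtain ⟨L, hL⟩ := hS x z hz N
  refine ⟨max K L, ?_⟩
  rintro x' _ hx' ⟨y', z', hy', hz', rfl⟩
  exact join_congr (hK x' y' (fun j hj => hx' j (lt_max_of_lt_left hj)) hy')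
    (hL x' z' (fun j hj => hx' j (lt_max_of_lt_right hj)) hz')

/-- The output which the instance `x` of `tJ(id)` prescribes, if there is one. -/
def Prescribes (x w : Baire) : Prop :=
  ∃ z, z ∈ Phi (x 0) (fun n => x (n + 2)) ∧ w ∈ Phi (x 1) (join (fun n => x (n + 2)) z)

theorem mem_totJump_id_iff_prescribes {x y : Baire} :
    y ∈ totJump idProblem x ↔ ∀ w, Prescribes x w → y = w := by
  rw [mem_totJump_id]
  exact ⟨fun h w ⟨z, hz, hw⟩ => h z w hz hw, fun h z w hz hw => h w ⟨z, hz, hw⟩⟩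

theorem relContinuous_prescribes : RelContinuous Prescribes := by
  rintro x w ⟨z, hz, hw⟩ N
  obtain ⟨K, hK⟩ := relContinuous_Phi (x 1) _ w hw N
  obtain ⟨L, hL⟩ := relContinuous_Phi (x 0) _ z hz K
  -- The extra `2` covers the indices at positions `0` and `1`, so that nearby instances run the
  -- same functionals.
  refine ⟨max K L + 2, ?_⟩
  rintro x' w' hx' ⟨z', hz', hw'⟩
  rw [hx' 0 (by omega)] at hz'
  rw [hx' 1 (by omega)] at hw'
  have hs : ∀ j < max K L, x' (j + 2) = x (j + 2) := fun j hj => hx' _ (by omega)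
  refine hK _ w' (join_congr (fun j hj => hs j (lt_max_of_lt_left hj)) ?_) hw'
  exact hL _ z' (fun j hj => hs j (lt_max_of_lt_right hj)) hz'

theorem relContinuous_eq : RelContinuous fun x y => y = x := by
  rintro x _ rfl N
  refine ⟨N, ?_⟩
  rintro x' _ hx' rfl
  exact hx'

theorem relContinuous_const (c : Baire) : RelContinuous fun _ y => y = c := by
  rintro x _ rfl N
  refine ⟨0, ?_⟩
  rintro x' _ - rfl
  exact fun _ _ => rfl

/-- A reduction to `tJ(id)` is solved by two continuous relations. -/
theorem exists_relContinuous_of_reducible {f : Problem} (h : Reducible f (totJump idProblem)) :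
    ∃ S : Bool → Baire → Baire → Prop, (∀ c, RelContinuous (S c)) ∧
      ∀ x ∈ f.dom, ∃ c, ∃ y ∈ f x, S c x y := by
  obtain ⟨F, G, ⟨a, rfl⟩, ⟨b, rfl⟩, hred⟩ := h
  -- Strategy `true` feeds `Φ_b` with the output prescribed by the instance `Φ_a(x)`, strategy
  -- `false` with the zero sequence.
  refine ⟨fun c x y => cond c
    (∃ v, (∃ u w, u = x ∧ (∃ r, r ∈ Phi a x ∧ Prescribes r w) ∧ v = join u w) ∧ y ∈ Phi b v)
    (∃ v, (∃ u w, u = x ∧ w = (fun _ => 0) ∧ v = join u w) ∧ y ∈ Phi b v), ?_, ?_⟩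
  · rintro (_ | _)
    · exact (relContinuous_eq.join (relContinuous_const _)).comp (relContinuous_Phi b)
    · exact (relContinuous_eq.join ((relContinuous_Phi a).comp relContinuous_prescribes)).comp
        (relContinuous_Phi b)
  · intro x hx
    obtain ⟨r, hr, -, hq⟩ := hred x hx
    by_cases hw : ∃ w, Prescribes r w
    · obtain ⟨w, hw⟩ := hw
      have hmem : w ∈ totJump idProblem r := by
        obtain ⟨y, hy⟩ := totJump_id_nonempty r
        rwa [← mem_totJump_id_iff_prescribes.1 hy w hw]
      obtain ⟨y, hy, hs⟩ := hq w hmem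
      exact ⟨true, y, hs, _, ⟨x, w, rfl, ⟨r, hr, hw⟩, rfl⟩, hy⟩
    · obtain ⟨y, hy, hs⟩ := hq (fun _ => 0)
        (mem_totJump_id_iff_prescribes.2 fun w h => absurd ⟨w, h⟩ hw)
      exact ⟨false, y, hs, _, ⟨x, _, rfl, rfl, rfl⟩, hy⟩

/-- Three families of searches, each close to the previous ones, force three different strategies,
but only two exist. -/
theorem not_parallelization_reducible_totJump_id :
    ¬ Reducible (parallelization (totJump idProblem)) (totJump idProblem) := by
  intro hred
  obtain ⟨S, hS, hsol⟩ := exists_relContinuous_of_reducible hred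
  obtain ⟨e, i, hei⟩ := exists_jumpInstance_LPO
  let X : (ℕ → Baire) → Baire := fun P m => jumpInstance e i (P m.unpair.1) m.unpair.2
  have hX : ∀ P j, component (X P) j = jumpInstance e i (P j) := by
    intro P j
    funext n
    simp [X, component]
  have hXc : ∀ (P P' : ℕ → Baire) K, (∀ l, ∀ j < K, P' l j = P l j) →
      ∀ j < K, X P' j = X P j := fun P P' K h j hj =>
    jumpInstance_congr e i (h _) _ ((Nat.unpair_right_le j).trans_lt hj)
  replace hsol : ∀ P, ∃ c y, S c (X P) y ∧
      ∀ j, (∃ n, P j n ≠ 0) → y (Nat.pair j 0) ≠ 0 ∧ P j (y (Nat.pair j 0) - 1) ≠ 0 := by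
    intro P
    obtain ⟨c, y, hy, hs⟩ := hsol (X P) (parallelization_totJump_id_nonempty _)
    refine ⟨c, y, hs, fun j hj => ?_⟩
    have := hy j
    rw [hX] at this
    exact hei _ _ this hj
  -- A strategy that handles a family whose `l`-th search fails has fixed its claimed witness there.
  -- Hence it cannot be right on a nearby family whose `l`-th search succeeds.
  have key : ∀ c P y l, S c (X P) y → P l = 0 → ∃ K, ∀ P' y', (∀ l, ∀ j < K, P' l j = P l j) →
      S c (X P') y' → (∀ j, (∃ n, P' j n ≠ 0) →
        y' (Nat.pair j 0) ≠ 0 ∧ P' j (y' (Nat.pair j 0) - 1) ≠ 0) → ∀ n, P' l n = 0 := by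
    intro c P y l hP hl
    obtain ⟨K, hK⟩ := hS c _ y hP (Nat.pair l 0 + 1)
    -- `K` preserves the claim `y (Nat.pair l 0)`; the other bound keeps the entry at the claimed
    -- witness equal to zero.
    refine ⟨max K (y (Nat.pair l 0)), fun P' y' hP' hy' hs => ?_⟩
    by_contra! hne
    obtain ⟨h1, h2⟩ := hs l hne
    have h3 : y' (Nat.pair l 0) = y (Nat.pair l 0) :=
      hK _ y' (hXc _ _ _ fun l j hj => hP' l j (lt_max_of_lt_left hj)) hy' _ (Nat.lt_succ_self _)
    rw [h3] at h1 h2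
    rw [hP' l _ (lt_max_of_lt_right (by omega)), hl] at h2
    exact h2 rfl
  let step : ℕ → Baire := fun K n => if n < K then 0 else 1
  have hstep : ∀ K, step K K ≠ 0 := fun K => by simp [step]
  have hstep0 : ∀ K L j, j < K → K ≤ L → step L j = 0 := fun K L j h1 h2 => by
    simp [step, h1.trans_le h2]
  obtain ⟨c₀, y₀, h₀, -⟩ := hsol fun _ => 0
  obtain ⟨K, hK⟩ := key c₀ (fun _ => 0) y₀ 0 h₀ rfl
  obtain ⟨c₁, y₁, h₁, hs₁⟩ := hsol fun l => if l = 0 then step K else 0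
  have hc₁ : c₁ ≠ c₀ := by
    rintro rfl
    refine hstep K ?_
    have := hK _ y₁ (fun l j hj => ?_) h₁ hs₁ K
    · simpa using this
    · by_cases hl : l = 0
      · simp [hl, hstep0 K K j hj le_rfl]
      · simp [hl]
  obtain ⟨L, hL⟩ := key c₁ (fun l => if l = 0 then step K else 0) y₁ 1 h₁ rfl
  -- With the delay `max K L` this family is close to the zero family, excluding `c₀`, and to the
  -- second family, excluding `c₁`.
  obtain ⟨c₂, y₂, h₂, hs₂⟩ := hsol fun l =>
    if l = 0 then step K else if l = 1 then step (max K L) else 0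
  have hc₂ : c₂ ≠ c₀ := by
    rintro rfl
    refine hstep K ?_
    have := hK _ y₂ (fun l j hj => ?_) h₂ hs₂ K
    · simpa using this
    · by_cases hl : l = 0
      · simp [hl, hstep0 K K j hj le_rfl]
      by_cases hl1 : l = 1
      · simp [hl1, hstep0 K _ j hj (le_max_left K L)]
      · simp [hl, hl1]
  have hc₂' : c₂ ≠ c₁ := by
    rintro rfl
    refine hstep (max K L) ?_
    have := hL _ y₂ (fun l j hj => ?_) h₂ hs₂ (max K L)
    · simpa using this
    · by_cases hl : l = 0
      · simp [hl]
      by_cases hl1 : l = 1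
      · simp [hl1, hstep0 L _ j hj (le_max_right K L)]
      · simp [hl, hl1]
  have hbool : ∀ a b c : Bool, b ≠ a → c ≠ a → c ≠ b → False := by decide
  exact hbool _ _ _ hc₁ hc₂ hc₂'

/-! ### The limit problem is below the parallelization of `tJ(id)` -/

theorem mem_limProblem {x y : Baire} :
    y ∈ limProblem x ↔ ∀ n, ∃ N, ∀ m ≥ N, x (Nat.pair m n) = y n := by
  simp only [limProblem, Set.mem_ofPred_eq, tendsto_pi_nhds, nhds_discrete, Filter.tendsto_pure,
    Filter.eventually_atTop, component]

/-- Search `⟨n, N⟩` looks for a change of digit `n` after stage `N`. Once its claimed witness is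
refuted there is no change, so the digit at stage `N` is the limit; convergence ensures that some
`N` passes. -/
theorem lim_reducible_parallelization_totJump_id :
    Reducible limProblem (parallelization (totJump idProblem)) := by
  obtain ⟨e, i, hei⟩ := exists_jumpInstance_LPO
  let change : Baire → ℕ → ℕ → Baire := fun x n N m =>
    if x (Nat.pair (N + m) n) = x (Nat.pair N n) then 0 else 1
  have hfwd : ∃ a, ∀ x : Baire, (fun k => jumpInstance e i
      (change x k.unpair.1.unpair.1 k.unpair.1.unpair.2) k.unpair.2) ∈ Phi a x := by
    have hn : Primrec fun k : ℕ => k.unpair.1.unpair.1 := Primrec.fst.comp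
      (Primrec.unpair.comp (Primrec.fst.comp Primrec.unpair))
    have hN : Primrec fun k : ℕ => k.unpair.1.unpair.2 := Primrec.snd.comp
      (Primrec.unpair.comp (Primrec.fst.comp Primrec.unpair))
    have hl : Primrec fun k : ℕ => k.unpair.2 := Primrec.snd.comp Primrec.unpair
    have hg : Primrec₂ fun (σ : List ℕ) (k : ℕ) => if k.unpair.2 = 0 then e else
        if k.unpair.2 = 1 then i else
        if σ.getD (Nat.pair (k.unpair.1.unpair.2 + (k.unpair.2 - 2)) k.unpair.1.unpair.1) 0 =
          σ.getD (Nat.pair k.unpair.1.unpair.2 k.unpair.1.unpair.1) 0 then 0 else 1 := by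
      refine Primrec.ite (Primrec.eq.comp (hl.comp .snd) (.const 0)) (.const e) ?_
      refine Primrec.ite (Primrec.eq.comp (hl.comp .snd) (.const 1)) (.const i) ?_
      refine Primrec.ite (Primrec.eq.comp ?_ ?_) (.const 0) (.const 1)
      · refine (Primrec.list_getD 0).comp .fst (Primrec₂.natPair.comp ?_ (hn.comp .snd))
        exact Primrec.nat_add.comp (hN.comp .snd) (Primrec.nat_sub.comp (hl.comp .snd) (.const 2))
      · exact (Primrec.list_getD 0).comp .fst (Primrec₂.natPair.comp (hN.comp .snd) (hn.comp .snd))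
    obtain ⟨a, ha⟩ := exists_Phi_of_bound
      (b := fun k => Nat.pair (k.unpair.1.unpair.2 + k.unpair.2) k.unpair.1.unpair.1 + 1)
      (Primrec.succ.comp (Primrec₂.natPair.comp (Primrec.nat_add.comp hN hl) hn)) hg
    refine ⟨a, fun x => ?_⟩
    convert ha x using 1
    funext k
    have hmono : ∀ m ≤ k.unpair.2, Nat.pair (k.unpair.1.unpair.2 + m) k.unpair.1.unpair.1 <
        Nat.pair (k.unpair.1.unpair.2 + k.unpair.2) k.unpair.1.unpair.1 + 1 := fun m hm => by
      rcases hm.eq_or_lt with rfl | hm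
      · exact Nat.lt_succ_self _
      · exact (Nat.pair_lt_pair_left _ (by omega)).trans (Nat.lt_succ_self _)
    rw [initSeg_getD x (hmono _ (by omega)), initSeg_getD x (by simpa using hmono 0 (Nat.zero_le _))]
    rfl
  obtain ⟨a, ha⟩ := hfwd
  -- A prefix of length `k` tests `N = k.unpair.1`, so each `N` recurs with arbitrarily long
  -- prefixes. `A`, `B`, `C` are the positions in the join of the answer `v` for `⟨n, N⟩`, of digit
  -- `n` at stage `N`, and of that digit at the claimed stage of change `N + (v - 1)`.
  have hh : Primrec₂ fun (σ : List ℕ) (n : ℕ) =>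
      (fun N A B => (fun v => (fun C =>
        if σ.length ≤ A then 0 else if σ.length ≤ B then 0 else
        if v = 0 then σ.getD B 0 + 1 else if σ.length ≤ C then 0 else
        if σ.getD C 0 = σ.getD B 0 then σ.getD B 0 + 1 else 0)
        (2 * Nat.pair (N + (v - 1)) n)) (σ.getD A 0))
        σ.length.unpair.1 (2 * Nat.pair (Nat.pair n σ.length.unpair.1) 0 + 1)
        (2 * Nat.pair σ.length.unpair.1 n) := by
    have hl : Primrec fun a : List ℕ × ℕ => a.1.length := Primrec.list_length.comp .fst
    have hN : Primrec fun a : List ℕ × ℕ => a.1.length.unpair.1 :=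
      Primrec.fst.comp (Primrec.unpair.comp hl)
    have hA : Primrec fun a : List ℕ × ℕ =>
        2 * Nat.pair (Nat.pair a.2 a.1.length.unpair.1) 0 + 1 :=
      Primrec.nat_double_succ.comp (Primrec₂.natPair.comp (Primrec₂.natPair.comp .snd hN) (.const 0))
    have hB : Primrec fun a : List ℕ × ℕ => 2 * Nat.pair a.1.length.unpair.1 a.2 :=
      Primrec.nat_double.comp (Primrec₂.natPair.comp hN .snd)
    have hv := (Primrec.list_getD 0).comp (Primrec.fst (α := List ℕ) (β := ℕ)) hA
    have hC := Primrec.nat_double.comp (Primrec₂.natPair.comp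
      (Primrec.nat_add.comp hN (Primrec.nat_sub.comp hv (.const 1))) .snd)
    have hBv := (Primrec.list_getD 0).comp (Primrec.fst (α := List ℕ) (β := ℕ)) hB
    have hCv := (Primrec.list_getD 0).comp (Primrec.fst (α := List ℕ) (β := ℕ)) hC
    refine Primrec.ite (Primrec.nat_le.comp hl hA) (.const 0) ?_
    refine Primrec.ite (Primrec.nat_le.comp hl hB) (.const 0) ?_
    refine Primrec.ite (Primrec.eq.comp hv (.const 0)) (Primrec.succ.comp hBv) ?_
    refine Primrec.ite (Primrec.nat_le.comp hl hC) (.const 0) ?_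
    exact Primrec.ite (Primrec.eq.comp hCv hBv) (Primrec.succ.comp hBv) (.const 0)
  obtain ⟨b, hb⟩ := exists_Phi_of_prefix hh
  refine ⟨Phi a, Phi b, ⟨a, rfl⟩, ⟨b, rfl⟩, fun x hx =>
    ⟨_, ha x, parallelization_totJump_id_nonempty _, fun q hq => ?_⟩⟩
  obtain ⟨y, hy⟩ := hx
  refine ⟨y, ?_, hy⟩
  rw [mem_limProblem] at hy
  have key : ∀ n N, (∃ m, change x n N m ≠ 0) → q (Nat.pair (Nat.pair n N) 0) ≠ 0 ∧
      change x n N (q (Nat.pair (Nat.pair n N) 0) - 1) ≠ 0 := by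
    intro n N
    have h := hq (Nat.pair n N)
    refine hei (change x n N) (component q (Nat.pair n N)) ?_
    convert h using 2
    funext k
    simp [component]
  have hstable : ∀ n N, (∀ m, change x n N m = 0) → x (Nat.pair N n) = y n := by
    intro n N h
    obtain ⟨M, hM⟩ := hy n
    rw [← hM (N + M) (by omega)]
    have := h M
    simp only [change] at this
    split_ifs at this with h1
    exact h1.symm
  have hread : ∀ {j k}, ¬ k ≤ 2 * j → (initSeg (join x q) k).getD (2 * j) 0 = x j :=
    fun h => by rw [initSeg_getD _ (by omega), join_even]
  have hread' : ∀ {j k}, ¬ k ≤ 2 * j + 1 → (initSeg (join x q) k).getD (2 * j + 1) 0 = q j :=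
    fun h => by rw [initSeg_getD _ (by omega), join_odd]
  refine hb _ y (fun n k => ?_) fun n => ?_
  · simp only [initSeg_length]
    generalize k.unpair.1 = N
    by_cases hA : k ≤ 2 * Nat.pair (Nat.pair n N) 0 + 1
    · left; rw [if_pos hA]
    by_cases hB : k ≤ 2 * Nat.pair N n
    · left; rw [if_neg hA, if_pos hB]
    rw [if_neg hA, if_neg hB, hread' hA, hread hB]
    by_cases hv : q (Nat.pair (Nat.pair n N) 0) = 0
    · right
      rw [if_pos hv, hstable n N]
      by_contra! hne
      exact (key n N hne).1 hv
    rw [if_neg hv]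
    by_cases hC : k ≤ 2 * Nat.pair (N + (q (Nat.pair (Nat.pair n N) 0) - 1)) n
    · left; rw [if_pos hC]
    rw [if_neg hC, hread hC]
    split_ifs with heq
    · right
      rw [hstable n N]
      by_contra! hne
      exact (key n N hne).2 (if_pos heq)
    · left; rfl
  · obtain ⟨N, hN⟩ := hy n
    set A := 2 * Nat.pair (Nat.pair n N) 0 + 1 with hA
    set B := 2 * Nat.pair N n with hB
    set C := 2 * Nat.pair (N + (q (Nat.pair (Nat.pair n N) 0) - 1)) n with hC
    -- This length selects `N` and exceeds every position to be read.
    refine ⟨Nat.pair N (A + B + C + 1), ?_⟩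
    have hk := Nat.right_le_pair N (A + B + C + 1)
    simp only [initSeg_length, Nat.unpair_pair]
    rw [hread' (by omega), hread (j := Nat.pair N n) (by omega), if_neg (by omega),
      if_neg (by omega)]
    split_ifs with h1 h2 h3
    · omega
    · omega
    · omega
    · rw [hread (by omega), hN _ le_rfl, hN _ (by omega)] at h3
      exact absurd rfl h3

/-! ### The parallelization of `tJ(id)` is below the limit problem -/

/-- The evaluation of `φ_e(σ[k], n)` in `s` steps. -/
def stageQuery (s e : ℕ) (σ : List ℕ) (n k : ℕ) : Option ℕ :=
  Code.evaln s (Denumerable.ofNat Code e) (Encodable.encode (σ.take k, n))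

/-- The first position at which `s` steps do not show that a longer prefix of `σ` is wanted. -/
def stageUse (s e : ℕ) (σ : List ℕ) (n : ℕ) : ℕ :=
  Nat.findGreatest (fun k => ∀ k' < k, stageQuery s e σ n k' = some 0) σ.length

/-- The approximation to the `n`-th digit of `Φ_e(p)` by `s` steps on the prefix `σ` of `p`:
`0` if there is no value yet and `v + 1` if the value is `v`. -/
def stageDigit (s e : ℕ) (σ : List ℕ) (n : ℕ) : ℕ :=
  (stageQuery s e σ n (stageUse s e σ n)).getD 0

/-- A nonzero value preceded only by zeros can sit only at `stageUse`, since a smaller position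
would carry the value `0`. -/
theorem stageDigit_eq_succ {s e : ℕ} {σ : List ℕ} {n v : ℕ} :
    stageDigit s e σ n = v + 1 ↔ ∃ k ≤ σ.length, stageQuery s e σ n k = some (v + 1) ∧
      ∀ k' < k, stageQuery s e σ n k' = some 0 := by
  have hspec : ∀ k' < stageUse s e σ n, stageQuery s e σ n k' = some 0 :=
    Nat.findGreatest_spec (P := fun k => ∀ k' < k, stageQuery s e σ n k' = some 0)
      (Nat.zero_le σ.length) (fun k' hk' => absurd hk' (Nat.not_lt_zero _))
  constructor
  · intro h
    refine ⟨stageUse s e σ n, Nat.findGreatest_le _, ?_, hspec⟩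
    unfold stageDigit at h
    cases hq : stageQuery s e σ n (stageUse s e σ n) with
    | none => rw [hq] at h; simp at h
    | some a => rw [hq] at h; simpa using h
  · rintro ⟨k, hk, hv, hlt⟩
    have h1 : k ≤ stageUse s e σ n := Nat.le_findGreatest hk hlt
    have h2 : k = stageUse s e σ n := by
      rcases h1.eq_or_lt with h | h
      · exact h
      · rw [hspec k h] at hv
        simp at hv
    rw [stageDigit, ← h2, hv]
    rfl

theorem stageQuery_mono {s s' e : ℕ} {σ σ' : List ℕ} {n k v : ℕ} (hs : s ≤ s') (hσ : σ <+: σ')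
    (hk : k ≤ σ.length) (h : stageQuery s e σ n k = some v) :
    stageQuery s' e σ' n k = some v := by
  obtain ⟨τ, rfl⟩ := hσ
  rw [stageQuery, List.take_append_of_le_length hk]
  exact Code.evaln_mono hs h

theorem stageDigit_mono {s s' e : ℕ} {σ σ' : List ℕ} {n v : ℕ} (hs : s ≤ s') (hσ : σ <+: σ')
    (h : stageDigit s e σ n = v + 1) : stageDigit s' e σ' n = v + 1 := by
  obtain ⟨k, hk, hv, hlt⟩ := stageDigit_eq_succ.1 h
  exact stageDigit_eq_succ.2 ⟨k, hk.trans hσ.length_le, stageQuery_mono hs hσ hk hv,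
    fun k' hk' => stageQuery_mono hs hσ (hk'.le.trans hk) (hlt k' hk')⟩

theorem stageQuery_sound {s e : ℕ} {p : Baire} {l n k v : ℕ} (hk : k ≤ l)
    (h : stageQuery s e (initSeg p l) n k = some v) : v ∈ query e p n k := by
  rw [stageQuery, take_initSeg p hk] at h
  exact Code.evaln_sound h

theorem stageDigit_sound {s e : ℕ} {p : Baire} {l n v : ℕ}
    (h : stageDigit s e (initSeg p l) n = v + 1) : v ∈ phiDigit e p n := by
  obtain ⟨k, hk, hv, hlt⟩ := stageDigit_eq_succ.1 h
  rw [initSeg_length] at hk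
  exact mem_phiDigit.2 ⟨k, stageQuery_sound hk hv,
    fun k' hk' => stageQuery_sound (hk'.le.trans hk) (hlt k' hk')⟩

theorem exists_stageQuery {e : ℕ} {p : Baire} {n k v : ℕ} (h : v ∈ query e p n k) :
    ∃ s, ∀ l ≥ k, stageQuery s e (initSeg p l) n k = some v := by
  obtain ⟨s, hs⟩ := Code.evaln_complete.1 h
  refine ⟨s, fun l hl => ?_⟩
  rw [stageQuery, take_initSeg p hl]
  exact hs

theorem exists_stageDigit {e : ℕ} {p : Baire} {n v : ℕ} (h : v ∈ phiDigit e p n) :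
    ∃ s₀, ∀ s ≥ s₀, ∀ l ≥ s₀, stageDigit s e (initSeg p l) n = v + 1 := by
  obtain ⟨k, hv, hlt⟩ := mem_phiDigit.1 h
  obtain ⟨s₁, hs₁⟩ := exists_stageQuery hv
  have hex : ∀ k', ∃ s, k' < k → ∀ l ≥ k', stageQuery s e (initSeg p l) n k' = some 0 := by
    intro k'
    by_cases hk' : k' < k
    · obtain ⟨s, hs⟩ := exists_stageQuery (hlt k' hk')
      exact ⟨s, fun _ => hs⟩
    · exact ⟨0, fun h => absurd h hk'⟩
  choose t ht using hex
  refine ⟨max k (max s₁ ((Finset.range k).sup t)), fun s hs l hl => ?_⟩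
  have hl' : k ≤ l := (le_max_left _ _).trans hl
  have hs1 : s₁ ≤ s := (le_max_left _ _).trans ((le_max_right _ _).trans hs)
  have hs2 : (Finset.range k).sup t ≤ s := (le_max_right _ _).trans ((le_max_right _ _).trans hs)
  refine stageDigit_eq_succ.2 ⟨k, by rwa [initSeg_length], ?_, fun k' hk' => ?_⟩
  · exact stageQuery_mono hs1 List.prefix_rfl (by rwa [initSeg_length]) (hs₁ l hl')
  · refine stageQuery_mono ((Finset.le_sup (f := t) (Finset.mem_range.2 hk')).trans hs2)
      List.prefix_rfl ?_ (ht k' hk' l (hk'.le.trans hl'))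
    rw [initSeg_length]
    exact hk'.le.trans hl'

/-- The number of digits of `Φ_e(p)` that are known after `s` steps on the prefix `σ` of `p`. -/
def stageLength (s e : ℕ) (σ : List ℕ) : ℕ :=
  Nat.findGreatest (fun m => ∀ m' < m, stageDigit s e σ m' ≠ 0) σ.length

/-- The prefix of the join of `p` and `Φ_e(p)` that is known after `s` steps on the prefix `σ`
of `p`. -/
def stageJoin (s e : ℕ) (σ : List ℕ) : List ℕ :=
  (List.range (2 * stageLength s e σ)).map fun t =>
    if t % 2 = 0 then σ.getD (t / 2) 0 else stageDigit s e σ (t / 2) - 1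

theorem stageLength_spec (s e : ℕ) (σ : List ℕ) :
    ∀ m < stageLength s e σ, stageDigit s e σ m ≠ 0 :=
  Nat.findGreatest_spec (P := fun m => ∀ m' < m, stageDigit s e σ m' ≠ 0)
    (Nat.zero_le σ.length) (fun _ h => absurd h (Nat.not_lt_zero _))

theorem stageLength_le (s e : ℕ) (σ : List ℕ) : stageLength s e σ ≤ σ.length :=
  Nat.findGreatest_le _

theorem le_stageLength {s e m : ℕ} {σ : List ℕ} (hm : m ≤ σ.length)
    (h : ∀ m' < m, stageDigit s e σ m' ≠ 0) : m ≤ stageLength s e σ :=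
  Nat.le_findGreatest hm h

theorem stageDigit_eq_of_ne_zero {s s' e : ℕ} {σ σ' : List ℕ} {n : ℕ} (hs : s ≤ s')
    (hσ : σ <+: σ') (h : stageDigit s e σ n ≠ 0) : stageDigit s' e σ' n = stageDigit s e σ n := by
  obtain ⟨v, hv⟩ := Nat.exists_eq_succ_of_ne_zero h
  rw [hv]
  exact stageDigit_mono hs hσ hv

theorem stageJoin_mono {s s' e : ℕ} {σ σ' : List ℕ} (hs : s ≤ s') (hσ : σ <+: σ') :
    stageJoin s e σ <+: stageJoin s' e σ' := by
  have hl : stageLength s e σ ≤ stageLength s' e σ' :=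
    le_stageLength ((stageLength_le s e σ).trans hσ.length_le) fun m hm => by
      rw [stageDigit_eq_of_ne_zero hs hσ (stageLength_spec s e σ m hm)]
      exact stageLength_spec s e σ m hm
  have : stageJoin s e σ = (stageJoin s' e σ').take (2 * stageLength s e σ) := by
    rw [stageJoin, stageJoin, ← List.map_take, List.take_range, min_eq_left (by omega)]
    refine List.map_congr_left fun t ht => ?_
    rw [List.mem_range] at ht
    have hd : t / 2 < stageLength s e σ := by omega
    rw [stageDigit_eq_of_ne_zero hs hσ (stageLength_spec s e σ _ hd)]
    obtain ⟨τ, rfl⟩ := hσ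
    rw [List.getD_append _ _ _ _ (hd.trans_le (stageLength_le s e σ))]
  rw [this]
  exact List.take_prefix _ _

/-- Known digits are correct by `stageDigit_sound`, so the second functional is only run on genuine
prefixes of its oracle. -/
theorem stageJoin_initSeg {s e l : ℕ} {p z : Baire} (hz : z ∈ Phi e p) :
    stageJoin s e (initSeg p l) = initSeg (join p z) (2 * stageLength s e (initSeg p l)) := by
  refine List.map_congr_left fun t ht => ?_
  rw [List.mem_range] at ht
  have hd : t / 2 < stageLength s e (initSeg p l) := by omega
  have hl := stageLength_le s e (initSeg p l)
  rw [initSeg_length] at hl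
  unfold join
  split_ifs
  · exact initSeg_getD p (hd.trans_le hl)
  · obtain ⟨v, hv⟩ := Nat.exists_eq_succ_of_ne_zero (stageLength_spec s e _ _ hd)
    rw [hv, Part.mem_unique (mem_Phi.1 hz (t / 2)) (stageDigit_sound hv)]
    rfl

theorem exists_le_stageLength {e : ℕ} {p z : Baire} (hz : z ∈ Phi e p) (m : ℕ) :
    ∃ s₀, ∀ s ≥ s₀, m ≤ stageLength s e (initSeg p s) := by
  choose t ht using fun n => exists_stageDigit (mem_Phi.1 hz n)
  refine ⟨max m ((Finset.range m).sup t), fun s hs => le_stageLength ?_ fun m' hm' => ?_⟩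
  · rw [initSeg_length]
    exact (le_max_left _ _).trans hs
  · have : t m' ≤ s := (Finset.le_sup (f := t) (Finset.mem_range.2 hm')).trans
      ((le_max_right _ _).trans hs)
    rw [ht m' s this s this]
    exact Nat.succ_ne_zero _

/-- The approximation to the `n`-th digit of `Φ_i(p, Φ_e(p))` by `s` steps on the prefix `σ`
of `p`. -/
def stageComp (s e i : ℕ) (σ : List ℕ) (n : ℕ) : ℕ :=
  stageDigit s i (stageJoin s e σ) n

theorem stageComp_mono {s s' e i : ℕ} {σ σ' : List ℕ} {n : ℕ} (hs : s ≤ s')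
    (hσ : σ <+: σ') (h : stageComp s e i σ n ≠ 0) : stageComp s' e i σ' n = stageComp s e i σ n :=
  stageDigit_eq_of_ne_zero hs (stageJoin_mono hs hσ) h

/-- By monotonicity the first nonzero approximation is final. Nothing is assumed about definedness,
which keeps the sequence in the domain of `lim` for every instance. -/
theorem exists_stageComp_eventually_const (e i : ℕ) (p : Baire) (n : ℕ) :
    ∃ v N, ∀ s ≥ N, stageComp s e i (initSeg p s) n = v := by
  by_cases h : ∃ s, stageComp s e i (initSeg p s) n ≠ 0
  · obtain ⟨s, hs⟩ := h
    exact ⟨_, s, fun s' hs' => stageComp_mono hs' (initSeg_prefix p hs') hs⟩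
  · push Not at h
    exact ⟨0, 0, fun s _ => h s⟩

theorem exists_stageComp_eq {e i : ℕ} {p z w : Baire} (hz : z ∈ Phi e p)
    (hw : w ∈ Phi i (join p z)) (n : ℕ) :
    ∃ N, ∀ s ≥ N, stageComp s e i (initSeg p s) n = w n + 1 := by
  obtain ⟨s₀, hs₀⟩ := exists_stageDigit (mem_Phi.1 hw n)
  obtain ⟨s₁, hs₁⟩ := exists_le_stageLength hz s₀
  refine ⟨max s₀ s₁, fun s hs => ?_⟩
  rw [stageComp, stageJoin_initSeg hz]
  have := hs₁ s ((le_max_right _ _).trans hs)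
  exact hs₀ s ((le_max_left _ _).trans hs) _ (by omega)

/-! ### Primitive recursiveness of the stage approximations -/

theorem primrec_stageQuery : Primrec fun a : (ℕ × ℕ) × (List ℕ × ℕ) × ℕ =>
    stageQuery a.1.1 a.1.2 a.2.1.1 a.2.1.2 a.2.2 := by
  refine Code.primrec_evaln.comp (Primrec.pair (Primrec.pair (Primrec.fst.comp .fst) ?_) ?_)
  · exact (Primrec.ofNat Code).comp (Primrec.snd.comp .fst)
  · exact Primrec.encode.comp (Primrec.pair (Primrec.list_take.comp (Primrec.snd.comp .snd)
      (Primrec.fst.comp (Primrec.fst.comp .snd))) (Primrec.snd.comp (Primrec.fst.comp .snd)))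

/-- The greatest number, up to a bound, below which a primitive recursive predicate holds. -/
theorem primrec_findGreatest_forall_lt {α : Type*} [Primcodable α] {f : α → ℕ}
    {P : α → ℕ → Prop} [∀ a, DecidablePred (P a)] (hf : Primrec f) (hP : PrimrecRel P) :
    Primrec fun a => Nat.findGreatest (fun k => ∀ k' < k, P a k') (f a) := by
  have hP' : PrimrecRel fun (k' : ℕ) (a : α) => P a k' := hP.comp₂ Primrec₂.right Primrec₂.left
  have hlt : PrimrecRel fun (a : α) (k : ℕ) => ∀ k' ∈ List.range k, P a k' :=
    hP'.forall_mem_list.comp₂ (Primrec.list_range.comp₂ Primrec₂.right) Primrec₂.left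
  exact Primrec.nat_findGreatest hf (hlt.of_eq fun a k => by simp only [List.mem_range])

theorem primrec_stageDigit : Primrec fun a : (ℕ × ℕ) × List ℕ × ℕ =>
    stageDigit a.1.1 a.1.2 a.2.1 a.2.2 := by
  have huse : Primrec fun a : (ℕ × ℕ) × List ℕ × ℕ => stageUse a.1.1 a.1.2 a.2.1 a.2.2 := by
    refine primrec_findGreatest_forall_lt (Primrec.list_length.comp (Primrec.fst.comp .snd)) ?_
    refine Primrec.eq.comp (primrec_stageQuery.comp (Primrec.pair (Primrec.fst.comp .fst)
      (Primrec.pair (Primrec.snd.comp .fst) .snd))) (.const (some 0))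
  exact Primrec.option_getD.comp (primrec_stageQuery.comp (Primrec.pair .fst
    (Primrec.pair .snd huse))) (.const 0)

theorem primrec_stageJoin : Primrec fun a : (ℕ × ℕ) × List ℕ => stageJoin a.1.1 a.1.2 a.2 := by
  have hdigit : Primrec₂ fun (a : (ℕ × ℕ) × List ℕ) (n : ℕ) => stageDigit a.1.1 a.1.2 a.2 n :=
    primrec_stageDigit.comp (Primrec.pair (Primrec.fst.comp .fst)
      (Primrec.pair (Primrec.snd.comp .fst) .snd))
  have hlen : Primrec fun a : (ℕ × ℕ) × List ℕ => stageLength a.1.1 a.1.2 a.2 := by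
    refine primrec_findGreatest_forall_lt (Primrec.list_length.comp .snd) ?_
    exact (Primrec.eq.comp hdigit (.const 0)).not
  refine Primrec.list_map (Primrec.list_range.comp (Primrec.nat_double.comp hlen)) ?_
  have hhalf : Primrec fun a : ((ℕ × ℕ) × List ℕ) × ℕ => a.2 / 2 :=
    Primrec.nat_div.comp .snd (.const 2)
  refine Primrec.ite (Primrec.eq.comp (Primrec.nat_mod.comp .snd (.const 2)) (.const 0)) ?_ ?_
  · exact (Primrec.list_getD 0).comp (Primrec.snd.comp .fst) hhalf
  · exact Primrec.nat_sub.comp (hdigit.comp .fst hhalf) (.const 1)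

theorem primrec_stageComp : Primrec fun a : (ℕ × ℕ × ℕ) × List ℕ × ℕ =>
    stageComp a.1.1 a.1.2.1 a.1.2.2 a.2.1 a.2.2 := by
  have hs : Primrec fun a : (ℕ × ℕ × ℕ) × List ℕ × ℕ => a.1.1 := Primrec.fst.comp .fst
  have he : Primrec fun a : (ℕ × ℕ × ℕ) × List ℕ × ℕ => a.1.2.1 :=
    Primrec.fst.comp (Primrec.snd.comp .fst)
  have hi : Primrec fun a : (ℕ × ℕ × ℕ) × List ℕ × ℕ => a.1.2.2 :=
    Primrec.snd.comp (Primrec.snd.comp .fst)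
  exact primrec_stageDigit.comp ((hs.pair hi).pair
    ((primrec_stageJoin.comp ((hs.pair he).pair (Primrec.fst.comp .snd))).pair
      (Primrec.snd.comp .snd)))

/-- The sequence whose `s`-th member consists of the approximations of stage `s` is computable. -/
theorem exists_Phi_stageComp : ∃ a, ∀ x : Baire, (fun k => stageComp k.unpair.1
    (component x k.unpair.2.unpair.1 0) (component x k.unpair.2.unpair.1 1)
    (initSeg (fun n => component x k.unpair.2.unpair.1 (n + 2)) k.unpair.1)
    k.unpair.2.unpair.2) ∈ Phi a x := by
  have hs : Primrec fun k : ℕ => k.unpair.1 := Primrec.fst.comp Primrec.unpair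
  have hj : Primrec fun k : ℕ => k.unpair.2.unpair.1 :=
    Primrec.fst.comp (Primrec.unpair.comp (Primrec.snd.comp Primrec.unpair))
  have hn : Primrec fun k : ℕ => k.unpair.2.unpair.2 :=
    Primrec.snd.comp (Primrec.unpair.comp (Primrec.snd.comp Primrec.unpair))
  have hread : ∀ c, Primrec fun a : List ℕ × ℕ => a.1.getD (Nat.pair a.2.unpair.2.unpair.1 c) 0 :=
    fun c => (Primrec.list_getD 0).comp .fst (Primrec₂.natPair.comp (hj.comp .snd) (.const c))
  have hg : Primrec₂ fun (σ : List ℕ) (k : ℕ) => stageComp k.unpair.1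
      (σ.getD (Nat.pair k.unpair.2.unpair.1 0) 0) (σ.getD (Nat.pair k.unpair.2.unpair.1 1) 0)
      ((List.range k.unpair.1).map fun t => σ.getD (Nat.pair k.unpair.2.unpair.1 (t + 2)) 0)
      k.unpair.2.unpair.2 := by
    refine primrec_stageComp.comp (((hs.comp .snd).pair ((hread 0).pair (hread 1))).pair
      (Primrec.pair ?_ (hn.comp .snd)))
    refine Primrec.list_map (Primrec.list_range.comp (hs.comp .snd)) ?_
    refine (Primrec.list_getD 0).comp (Primrec.fst.comp .fst) (Primrec₂.natPair.comp
      (hj.comp (Primrec.snd.comp .fst)) (Primrec.nat_add.comp .snd (.const 2)))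
  -- Stage `s` reads the two indices and `s` oracle entries of component `j`, hence only positions
  -- `Nat.pair j c` with `c < s + 2`.
  obtain ⟨a, ha⟩ := exists_Phi_of_bound
    (b := fun k => Nat.pair k.unpair.2.unpair.1 (k.unpair.1 + 2))
    (Primrec₂.natPair.comp hj (Primrec.nat_add.comp hs (.const 2))) hg
  refine ⟨a, fun x => ?_⟩
  convert ha x using 1
  funext k
  have hr : ∀ c < k.unpair.1 + 2, (initSeg x (Nat.pair k.unpair.2.unpair.1 (k.unpair.1 + 2))).getD
      (Nat.pair k.unpair.2.unpair.1 c) 0 = component x k.unpair.2.unpair.1 c :=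
    fun c hc => initSeg_getD x (Nat.pair_lt_pair_right _ hc)
  rw [hr 0 (by omega), hr 1 (by omega)]
  congr 1
  refine List.map_congr_left fun t ht => (hr _ ?_).symm
  have := List.mem_range.1 ht
  omega

theorem parallelization_totJump_id_reducible_lim :
    Reducible (parallelization (totJump idProblem)) limProblem := by
  obtain ⟨a, ha⟩ := exists_Phi_stageComp
  -- The limit occupies the odd positions of the join and holds digits shifted by one, which
  -- `Nat.pred` undoes; a digit never found becomes `0`, harmless as such an instance accepts
  -- everything.
  obtain ⟨b, hb⟩ := exists_Phi_reindex Primrec.nat_double_succ Primrec.pred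
  refine ⟨Phi a, Phi b, ⟨a, rfl⟩, ⟨b, rfl⟩, fun x _ => ⟨_, ha x, ?_, fun q hq => ⟨_, hb _, ?_⟩⟩⟩
  · choose v hv using fun m : ℕ => exists_stageComp_eventually_const
      (component x m.unpair.1 0) (component x m.unpair.1 1)
      (fun n => component x m.unpair.1 (n + 2)) m.unpair.2
    refine ⟨v, mem_limProblem.2 fun m => ?_⟩
    obtain ⟨N, hN⟩ := hv m
    exact ⟨N, fun s hs => by simpa using hN s hs⟩
  · refine fun j => mem_totJump_id.2 fun z w hz hw => funext fun n => ?_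
    obtain ⟨N, hN⟩ := exists_stageComp_eq hz hw n
    obtain ⟨M, hM⟩ := mem_limProblem.1 hq (Nat.pair j n)
    have h1 := hM (max M N) (le_max_left _ _)
    have h2 := hN (max M N) (le_max_right _ _)
    simp only [Nat.unpair_pair] at h1
    simp only [component, join_odd] at h1 h2 ⊢
    rw [← h1, h2]
    rfl

end Weihrauch

theorem mainTheorem9 :
    Weihrauch.StrictlyReducible Weihrauch.LPO (Weihrauch.totJump Weihrauch.idProblem) ∧
    Weihrauch.StrictlyReducible (Weihrauch.totJump Weihrauch.idProblem)
      (Weihrauch.parallelization (Weihrauch.totJump Weihrauch.idProblem)) ∧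
    Weihrauch.Equivalent (Weihrauch.parallelization (Weihrauch.totJump Weihrauch.idProblem))
      Weihrauch.limProblem :=
  ⟨⟨Weihrauch.LPO_reducible_totJump_id, Weihrauch.not_totJump_id_reducible_LPO⟩,
    ⟨Weihrauch.totJump_id_reducible_parallelization,
      Weihrauch.not_parallelization_reducible_totJump_id⟩,
    ⟨Weihrauch.parallelization_totJump_id_reducible_lim,
      Weihrauch.lim_reducible_parallelization_totJump_id⟩⟩
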